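/- Let $M$ be a smooth $n$-dimensional manifold, and let $g$ and $\bar g$ be smooth Lorentz metrics on $M$ (signature $(-1,1,\dots,1)$) linked by a generalized Kerr--Schild relation $\bar g = g + 2H\,\ell\otimes\ell$, where $H$ is a function on $M$ and $\ell$ is a smooth 1-form which is null with respect to $g$. Put $\ell^\alpha = g^{\alpha\beta}\ell_\beta$, $a^\alpha = \ell^\lambda\nabla_\lambda\ell^\alpha$ and $a^2 = g_{\lambda\mu}a^\lambda a^\mu$, where $\nabla$ is the Levi-Civita connection of $g$. Suppose that $\ell$ is non-geodesic: at no point is $a^\alpha$ a multiple of $\ell^\alpha$. Let $R_{\lambda\mu}$ and $\bar R_{\lambda\mu}$ be the Ricci tensors of $g$ and $\bar g$, and for a metric $\gamma$ let $R^\alpha{}_{\beta\gamma\delta}[\gamma]$ be its Riemann tensor, with the conventions $$R^\alpha{}_{\beta\gamma\delta} = \partial_\gamma\Gamma^\alpha_{\beta\delta} - \partial_\delta\Gamma^\alpha_{\beta\gamma} + \Gamma^\alpha_{\gamma\lambda}\Gamma^\lambda_{\beta\delta} - \Gamma^\alpha_{\delta\lambda}\Gamma^\lambda_{\beta\gamma},\qquad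 R_{\alpha\beta} = R^\lambda{}_{\alpha\lambda\beta}.$$ Then, in every coordinate chart: $a^2$ vanishes nowhere; $\bar g^{\alpha\beta}\ell_\beta = \ell^\alpha$, and the square $\bar a^2$ of the acceleration of $\ell$ computed with $\bar g$ and its Levi-Civita connection equals $a^2$; the tensors $g + (R_{\lambda\mu}\ell^\lambda\ell^\mu/a^2)\,\ell\otimes\ell$ and $\bar g + (\bar R_{\lambda\mu}\ell^\lambda\ell^\mu/a^2)\,\ell\otimes\ell$ are smooth Lorentz metrics; and $$R^\alpha{}_{\beta\gamma\delta}\Big[g + \frac{R_{\lambda\mu}\ell^\lambda\ell^\mu}{a^2}\,\ell\otimes\ell\Big] = R^\alpha{}_{\beta\gamma\delta}\Big[\bar g + \frac{\bar R_{\lambda\mu}\ell^\lambda\ell^\mu}{a^2}\,\ell\otimes\ell\Big].$$ -/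

import Mathlib

open scoped Manifold ContDiff

noncomputable section

namespace KerrSchild

/-- The coordinate space `ℝⁿ`. -/
abbrev Coord (n : ℕ) : Type := EuclideanSpace ℝ (Fin n)

/-! ### Tensor calculus in coordinates

A covariant 2-tensor field is given by its matrix of components `G y i j`, a 1-form by its
components `θ y i`, a vector field by its components `v y i`, all as functions of `y : Coord n`. -/

section Coordinates

variable {n : ℕ}

/-- The partial derivative `∂ᵢ f` at `y`. -/
def partialDeriv (i : Fin n) (f : Coord n → ℝ) (y : Coord n) : ℝ :=
  fderiv ℝ f y (EuclideanSpace.single i 1)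

/-- The Christoffel symbols
`Γᵃ_{bc} = (1/2) gᵃᵈ (∂_b g_{dc} + ∂_c g_{db} - ∂_d g_{bc})`. -/
def christoffel (G : Coord n → Matrix (Fin n) (Fin n) ℝ) (a b c : Fin n) (y : Coord n) : ℝ :=
  (1 / 2) * ∑ d, (G y)⁻¹ a d *
    (partialDeriv b (fun z => G z d c) y + partialDeriv c (fun z => G z d b) y
      - partialDeriv d (fun z => G z b c) y)

/-- The Riemann tensor
`Rᵃ_{bcd} = ∂_c Γᵃ_{bd} - ∂_d Γᵃ_{bc} + Γᵃ_{cl} Γˡ_{bd} - Γᵃ_{dl} Γˡ_{bc}`. -/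
def riemann (G : Coord n → Matrix (Fin n) (Fin n) ℝ) (a b c d : Fin n) (y : Coord n) : ℝ :=
  partialDeriv c (christoffel G a b d) y - partialDeriv d (christoffel G a b c) y
    + ∑ l, christoffel G a c l y * christoffel G l b d y
    - ∑ l, christoffel G a d l y * christoffel G l b c y

/-- The Ricci tensor `R_{ab} = Rˡ_{alb}`. -/
def ricci (G : Coord n → Matrix (Fin n) (Fin n) ℝ) (a b : Fin n) (y : Coord n) : ℝ :=
  ∑ l, riemann G l a l b y

/-- The vector field `θᵃ = gᵃᵇ θ_b` metrically equivalent to the 1-form `θ`. -/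
def raise (G : Coord n → Matrix (Fin n) (Fin n) ℝ) (θ : Coord n → Fin n → ℝ)
    (y : Coord n) (a : Fin n) : ℝ :=
  ∑ b, (G y)⁻¹ a b * θ y b

/-- The acceleration `vˡ ∇_l vᵃ` of the vector field `v`, for the Levi-Civita connection. -/
def acceleration (G : Coord n → Matrix (Fin n) (Fin n) ℝ) (v : Coord n → Fin n → ℝ)
    (y : Coord n) (a : Fin n) : ℝ :=
  ∑ l, v y l * (partialDeriv l (fun z => v z a) y + ∑ m, christoffel G a l m y * v y m)

/-- The square `g_{lm} aˡ aᵐ` of the acceleration of `v`. -/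
def accelerationSq (G : Coord n → Matrix (Fin n) (Fin n) ℝ) (v : Coord n → Fin n → ℝ)
    (y : Coord n) : ℝ :=
  ∑ l, ∑ m, G y l m * acceleration G v y l * acceleration G v y m

/-- The scalar `R_{lm} vˡ vᵐ`. -/
def ricciContracted (G : Coord n → Matrix (Fin n) (Fin n) ℝ) (v : Coord n → Fin n → ℝ)
    (y : Coord n) : ℝ :=
  ∑ l, ∑ m, ricci G l m y * v y l * v y m

/-- The tensor field `g + f θ ⊗ θ`. -/
def addSq (G : Coord n → Matrix (Fin n) (Fin n) ℝ) (f : Coord n → ℝ)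
    (θ : Coord n → Fin n → ℝ) : Coord n → Matrix (Fin n) (Fin n) ℝ :=
  fun y => G y + f y • Matrix.vecMulVec (θ y) (θ y)

end Coordinates

/-- A real bilinear form is Lorentzian, i.e. symmetric of signature `(-1, 1, …, 1)`, if it has a
timelike vector on whose orthogonal complement it is positive definite. -/
def IsLorentzian {V : Type*} [AddCommGroup V] [Module ℝ V] (B : LinearMap.BilinForm ℝ V) : Prop :=
  (∀ v w, B v w = B w v) ∧ ∃ u, B u u < 0 ∧ ∀ w, B u w = 0 → w ≠ 0 → 0 < B w w

/-- A matrix-valued function is a smooth Lorentz metric on the set `s`. -/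
def IsLorentzMetricOn {n : ℕ} (G : Coord n → Matrix (Fin n) (Fin n) ℝ)
    (s : Set (Coord n)) : Prop :=
  (∀ i j, ContDiffOn ℝ ∞ (fun y => G y i j) s) ∧ ∀ y ∈ s, IsLorentzian (Matrix.toBilin' (G y))

/-! ### Tensor fields on a manifold -/

section Manifold

variable {n : ℕ} {M : Type*} [TopologicalSpace M] [ChartedSpace (Coord n) M]

/-- The `i`-th coordinate vector of the chart `e` at the point with coordinates `y`. -/
def coordVector (e : OpenPartialHomeomorph M (Coord n)) (y : Coord n) (i : Fin n) :
    TangentSpace (𝓡 n) (e.symm y) :=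
  mfderiv (𝓡 n) (𝓡 n) e.symm y (EuclideanSpace.single i (1 : ℝ) : Coord n)

/-- The components in the chart `e` of a field of bilinear forms. -/
def bilinComponents (g : ∀ p : M, LinearMap.BilinForm ℝ (TangentSpace (𝓡 n) p))
    (e : OpenPartialHomeomorph M (Coord n)) (y : Coord n) : Matrix (Fin n) (Fin n) ℝ :=
  Matrix.of fun i j => g (e.symm y) (coordVector e y i) (coordVector e y j)

/-- The components in the chart `e` of a field of linear forms. -/
def formComponents (θ : ∀ p : M, TangentSpace (𝓡 n) p →ₗ[ℝ] ℝ)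
    (e : OpenPartialHomeomorph M (Coord n)) (y : Coord n) (i : Fin n) : ℝ :=
  θ (e.symm y) (coordVector e y i)

end Manifold

/-- A smooth Lorentz metric on a smooth `n`-manifold. -/
structure LorentzMetric (n : ℕ) (M : Type*) [TopologicalSpace M] [ChartedSpace (Coord n) M] where
  /-- The bilinear form on each tangent space. -/
  form : ∀ p : M, LinearMap.BilinForm ℝ (TangentSpace (𝓡 n) p)
  lorentzian : ∀ p, IsLorentzian (form p)
  smooth : ∀ e ∈ IsManifold.maximalAtlas (𝓡 n) ∞ M, ∀ i j,
    ContDiffOn ℝ ∞ (fun y => bilinComponents form e y i j) e.target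

/-- A smooth 1-form on a smooth `n`-manifold. -/
structure OneForm (n : ℕ) (M : Type*) [TopologicalSpace M] [ChartedSpace (Coord n) M] where
  /-- The linear form on each tangent space. -/
  form : ∀ p : M, TangentSpace (𝓡 n) p →ₗ[ℝ] ℝ
  smooth : ∀ e ∈ IsManifold.maximalAtlas (𝓡 n) ∞ M, ∀ i,
    ContDiffOn ℝ ∞ (fun y => formComponents form e y i) e.target

section Manifold

variable {n : ℕ} {M : Type*} [TopologicalSpace M] [ChartedSpace (Coord n) M]

/-- The components `g_{ij}` of a metric in a chart. -/
def LorentzMetric.components (g : LorentzMetric n M) (e : OpenPartialHomeomorph M (Coord n)) :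
    Coord n → Matrix (Fin n) (Fin n) ℝ :=
  bilinComponents g.form e

/-- The components `ℓ_i` of a 1-form in a chart. -/
def OneForm.components (θ : OneForm n M) (e : OpenPartialHomeomorph M (Coord n)) :
    Coord n → Fin n → ℝ :=
  formComponents θ.form e

/-- The components `ℓⁱ = gⁱʲ ℓ_j` in a chart of the vector field equivalent to a 1-form. -/
def OneForm.vector (θ : OneForm n M) (g : LorentzMetric n M)
    (e : OpenPartialHomeomorph M (Coord n)) : Coord n → Fin n → ℝ :=
  raise (g.components e) (θ.components e)

/-- The 1-form `θ` is null: `θ_i θⁱ = 0`. -/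
def OneForm.IsNull (θ : OneForm n M) (g : LorentzMetric n M) : Prop :=
  ∀ e ∈ IsManifold.maximalAtlas (𝓡 n) ∞ M, ∀ y ∈ e.target,
    ∑ i, θ.components e y i * θ.vector g e y i = 0

/-- The vector field `v` equivalent to `θ` is non-geodesic: at no point is its acceleration
`∇_v v` a multiple of `v`. -/
def OneForm.IsNonGeodesic (θ : OneForm n M) (g : LorentzMetric n M) : Prop :=
  ∀ e ∈ IsManifold.maximalAtlas (𝓡 n) ∞ M, ∀ y ∈ e.target,
    ¬ ∃ c : ℝ, acceleration (g.components e) (θ.vector g e) y = c • θ.vector g e y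

end Manifold

end KerrSchild

end

open scoped Topology

noncomputable section

namespace KerrSchild

/-! ### Smoothness and locality of the coordinate expressions. -/

section Calculus

variable {n : ℕ} {U : Set (Coord n)} {y : Coord n}

/-! The two deformed metrics are one and the same tensor. Write ḡ = g + h ℓ⊗ℓ with h = 2H. The heart
of the proof is the identity R̄(ℓ,ℓ) = R(ℓ,ℓ) - h a² (`ricciContracted_eq`): dividing by a², the
term h ℓ⊗ℓ that separates ḡ from g is cancelled exactly, so the Riemann tensors agree because the
metrics do.

The identity is proved with the difference tensor C = Γ̄ - Γ, governed by ∇(h ℓ⊗ℓ). Nullity gives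
ℓ^d ∇_b ℓ_d = 0, hence C^a_{ba} = 0 (`christoffelDiff_trace`) and, after one contraction with ℓ, an
explicit B^a_c = C^a_{bc} ℓ^b (`sum_christoffelDiff_mul`). A second contraction vanishes, so ℓ has
the same acceleration for both metrics. With the traces gone, R̄ - R = ∇_l C^l_{bd} - C^l_{dm}
C^m_{bl}. Contracted twice with ℓ, the quadratic term becomes tr(B²) = 0, while differentiating
C^l_{bd} ℓ^b ℓ^d = 0 turns the divergence into -2 B^l_d ∇_l ℓ^d = -h a².

The scalar a² is positive because the acceleration is orthogonal to the null vector ℓ and not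
proportional to it (`pos_of_orthogonal_null`). Adding f ℓ⊗ℓ amounts to pulling g back by a shear, so
the signature is kept (`add_sq_null`). -/

theorem partialDeriv_congr {f f' : Coord n → ℝ} (hf : f =ᶠ[𝓝 y] f') (i : Fin n) :
    partialDeriv i f y = partialDeriv i f' y := by
  simp only [partialDeriv, hf.fderiv_eq]

theorem partialDeriv_add {f f' : Coord n → ℝ} (hf : DifferentiableAt ℝ f y)
    (hf' : DifferentiableAt ℝ f' y) (i : Fin n) :
    partialDeriv i (fun z => f z + f' z) y = partialDeriv i f y + partialDeriv i f' y := by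
  simp [partialDeriv, fderiv_fun_add hf hf']

theorem partialDeriv_mul {f f' : Coord n → ℝ} (hf : DifferentiableAt ℝ f y)
    (hf' : DifferentiableAt ℝ f' y) (i : Fin n) :
    partialDeriv i (fun z => f z * f' z) y =
      partialDeriv i f y * f' y + f y * partialDeriv i f' y := by
  simp [partialDeriv, fderiv_fun_mul hf hf']
  ring

theorem partialDeriv_sum {ι : Type*} (s : Finset ι) {f : ι → Coord n → ℝ}
    (hf : ∀ j ∈ s, DifferentiableAt ℝ (f j) y) (i : Fin n) :
    partialDeriv i (fun z => ∑ j ∈ s, f j z) y = ∑ j ∈ s, partialDeriv i (f j) y := by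
  simp [partialDeriv, fderiv_fun_sum hf]

theorem partialDeriv_eq_zero (hU : IsOpen U) (hy : y ∈ U) {f : Coord n → ℝ}
    (hf : ∀ z ∈ U, f z = 0) (i : Fin n) : partialDeriv i f y = 0 := by
  have : f =ᶠ[𝓝 y] fun _ => 0 := by
    filter_upwards [hU.mem_nhds hy] with z hz using hf z hz
  rw [partialDeriv_congr this]
  simp [partialDeriv]

theorem contDiffOn_partialDeriv (hU : IsOpen U) {f : Coord n → ℝ} (hf : ContDiffOn ℝ ∞ f U)
    (i : Fin n) : ContDiffOn ℝ ∞ (partialDeriv i f) U :=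
  (hf.fderiv_of_isOpen hU (by simp)).clm_apply contDiffOn_const

theorem _root_.ContDiffOn.differentiableAt_of_isOpen {f : Coord n → ℝ} (hf : ContDiffOn ℝ ∞ f U)
    (hU : IsOpen U) (hy : y ∈ U) : DifferentiableAt ℝ f y :=
  (hf.contDiffAt (hU.mem_nhds hy)).differentiableAt (by simp)

theorem contDiffOn_det {A : Coord n → Matrix (Fin n) (Fin n) ℝ}
    (hA : ∀ i j, ContDiffOn ℝ ∞ (fun y => A y i j) U) :
    ContDiffOn ℝ ∞ (fun y => (A y).det) U := by
  simp only [Matrix.det_apply']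
  exact ContDiffOn.sum fun σ _ => contDiffOn_const.mul (contDiffOn_prod fun i _ => hA _ _)

theorem contDiffOn_inv {A : Coord n → Matrix (Fin n) (Fin n) ℝ}
    (hA : ∀ i j, ContDiffOn ℝ ∞ (fun y => A y i j) U) (hdet : ∀ y ∈ U, (A y).det ≠ 0)
    (i j : Fin n) : ContDiffOn ℝ ∞ (fun y => (A y)⁻¹ i j) U := by
  simp only [Matrix.inv_def, Ring.inverse_eq_inv', Matrix.smul_apply, smul_eq_mul,
    Matrix.adjugate_apply]
  refine ((contDiffOn_det hA).inv hdet).mul (contDiffOn_det fun a b => ?_)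
  by_cases h : a = j
  · subst h
    simpa using contDiffOn_const
  · simpa [Matrix.updateRow_ne h] using hA a b

variable {G : Coord n → Matrix (Fin n) (Fin n) ℝ} {v θ : Coord n → Fin n → ℝ}

theorem contDiffOn_christoffel (hU : IsOpen U) (hG : ∀ i j, ContDiffOn ℝ ∞ (fun y => G y i j) U)
    (hdet : ∀ y ∈ U, (G y).det ≠ 0) (a b c : Fin n) :
    ContDiffOn ℝ ∞ (christoffel G a b c) U :=
  contDiffOn_const.mul <| ContDiffOn.sum fun d _ => (contDiffOn_inv hG hdet a d).mul <|
    ((contDiffOn_partialDeriv hU (hG d c) b).add (contDiffOn_partialDeriv hU (hG d b) c)).sub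
      (contDiffOn_partialDeriv hU (hG b c) d)

theorem contDiffOn_raise (hG : ∀ i j, ContDiffOn ℝ ∞ (fun y => G y i j) U)
    (hdet : ∀ y ∈ U, (G y).det ≠ 0) (hθ : ∀ i, ContDiffOn ℝ ∞ (fun y => θ y i) U) (a : Fin n) :
    ContDiffOn ℝ ∞ (fun y => raise G θ y a) U :=
  ContDiffOn.sum fun b _ => (contDiffOn_inv hG hdet a b).mul (hθ b)

theorem contDiffOn_ricciContracted (hU : IsOpen U)
    (hG : ∀ i j, ContDiffOn ℝ ∞ (fun y => G y i j) U) (hdet : ∀ y ∈ U, (G y).det ≠ 0)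
    (hv : ∀ i, ContDiffOn ℝ ∞ (fun y => v y i) U) :
    ContDiffOn ℝ ∞ (ricciContracted G v) U := by
  have hΓ := contDiffOn_christoffel hU hG hdet
  refine ContDiffOn.sum fun l _ => ContDiffOn.sum fun m _ => ContDiffOn.mul (ContDiffOn.mul ?_
    (hv l)) (hv m)
  refine ContDiffOn.sum fun a _ => ContDiffOn.sub (ContDiffOn.add (ContDiffOn.sub ?_ ?_) ?_) ?_
  · exact contDiffOn_partialDeriv hU (hΓ _ _ _) _
  · exact contDiffOn_partialDeriv hU (hΓ _ _ _) _
  · exact ContDiffOn.sum fun b _ => (hΓ _ _ _).mul (hΓ _ _ _)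
  · exact ContDiffOn.sum fun b _ => (hΓ _ _ _).mul (hΓ _ _ _)

theorem contDiffOn_accelerationSq (hU : IsOpen U)
    (hG : ∀ i j, ContDiffOn ℝ ∞ (fun y => G y i j) U) (hdet : ∀ y ∈ U, (G y).det ≠ 0)
    (hv : ∀ i, ContDiffOn ℝ ∞ (fun y => v y i) U) :
    ContDiffOn ℝ ∞ (accelerationSq G v) U := by
  have ha : ∀ a, ContDiffOn ℝ ∞ (fun y => acceleration G v y a) U := fun a =>
    ContDiffOn.sum fun l _ => (hv l).mul <| (contDiffOn_partialDeriv hU (hv a) l).add <|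
      ContDiffOn.sum fun m _ => (contDiffOn_christoffel hU hG hdet a l m).mul (hv m)
  exact ContDiffOn.sum fun l _ => ContDiffOn.sum fun m _ => ((hG l m).mul (ha l)).mul (ha m)

theorem christoffel_congr {G' : Coord n → Matrix (Fin n) (Fin n) ℝ} (h : G =ᶠ[𝓝 y] G')
    (a b c : Fin n) : christoffel G a b c y = christoffel G' a b c y := by
  have hp : ∀ i j k, partialDeriv k (fun z => G z i j) y = partialDeriv k (fun z => G' z i j) y :=
    fun i j k => partialDeriv_congr (h.mono fun z hz => by simp only [hz]) k
  simp only [christoffel, hp, h.eq_of_nhds]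

/-- Second derivatives of the metric occur, so agreement is needed on a neighbourhood: the
Christoffel symbols must coincide near the point before they are differentiated. -/
theorem riemann_congr {G' : Coord n → Matrix (Fin n) (Fin n) ℝ} (h : G =ᶠ[𝓝 y] G')
    (a b c d : Fin n) : riemann G a b c d y = riemann G' a b c d y := by
  have hp : ∀ i j k m, partialDeriv k (christoffel G m i j) y =
      partialDeriv k (christoffel G' m i j) y := fun i j k m =>
    partialDeriv_congr (h.eventuallyEq_nhds.mono fun z hz => christoffel_congr hz m i j) k
  simp only [riemann, hp, christoffel_congr h]

theorem accelerationSq_congr {v' : Coord n → Fin n → ℝ} (h : v =ᶠ[𝓝 y] v') :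
    accelerationSq G v y = accelerationSq G v' y := by
  have hp : ∀ i k, partialDeriv k (fun z => v z i) y = partialDeriv k (fun z => v' z i) y :=
    fun i k => partialDeriv_congr (h.mono fun z hz => by simp only [hz]) k
  simp only [accelerationSq, acceleration, hp, h.eq_of_nhds]

/-- The factor of a smooth multiple `f θ ⊗ θ` is smooth where `θ` does not vanish. -/
theorem contDiffOn_factor (hU : IsOpen U) {f : Coord n → ℝ}
    {G' : Coord n → Matrix (Fin n) (Fin n) ℝ} (hG : ∀ i j, ContDiffOn ℝ ∞ (fun y => G y i j) U)
    (hG' : ∀ i j, ContDiffOn ℝ ∞ (fun y => G' y i j) U)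
    (hθ : ∀ i, ContDiffOn ℝ ∞ (fun y => θ y i) U) (hθ0 : ∀ y ∈ U, θ y ≠ 0)
    (h : ∀ y ∈ U, G' y = addSq G f θ y) : ContDiffOn ℝ ∞ f U := by
  intro y hy
  obtain ⟨i, hi⟩ := Function.ne_iff.1 (hθ0 y hy)
  have hUy := hU.mem_nhds hy
  have hθi := (hθ i).contDiffAt hUy
  -- Near a point where `θ i` is nonzero, the diagonal entry `i i` of the relation can be solved for
  -- `f`.
  have hq : ContDiffAt ℝ ∞ (fun z => (G' z i i - G z i i) / (θ z i * θ z i)) y :=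
    (((hG' i i).contDiffAt hUy).sub ((hG i i).contDiffAt hUy)).div (hθi.mul hθi)
      (mul_ne_zero hi hi)
  refine (hq.congr_of_eventuallyEq ?_).contDiffWithinAt
  filter_upwards [hUy, hθi.continuousAt.eventually_ne hi] with z hz hzi
  simp only [Pi.zero_apply] at hzi
  rw [h z hz]
  simp only [addSq, Matrix.add_apply, Matrix.smul_apply, Matrix.vecMulVec_apply, smul_eq_mul]
  field_simp
  ring

end Calculus

/-! ### Linear algebra of Lorentzian forms. -/

section LorentzAlgebra

variable {V W : Type*} [AddCommGroup V] [Module ℝ V] [AddCommGroup W] [Module ℝ W]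
  {B : LinearMap.BilinForm ℝ V}

theorem IsLorentzian.of_equiv (hB : IsLorentzian B) (T : W ≃ₗ[ℝ] V) {B' : LinearMap.BilinForm ℝ W}
    (h : ∀ x y, B' x y = B (T x) (T y)) : IsLorentzian B' := by
  obtain ⟨hs, u, hu, hp⟩ := hB
  refine ⟨fun x y => by rw [h, h, hs], T.symm u, by simpa [h] using hu, fun w hw hw0 => ?_⟩
  rw [h] at hw ⊢
  exact hp _ (by simpa using hw) (by simpa using hw0)

/-- Testing against `u` puts `x` in the positive definite complement; testing against `x` itself
then forces `x = 0`. -/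
theorem IsLorentzian.eq_zero_of_forall (hB : IsLorentzian B) {x : V} (h : ∀ w, B w x = 0) :
    x = 0 := by
  obtain ⟨_, u, _, hp⟩ := hB
  by_contra hx
  exact absurd (h x) (hp x (h u) hx).ne'

/-- A vector orthogonal to a null vector and not a multiple of it is spacelike. -/
theorem IsLorentzian.pos_of_orthogonal_null (hB : IsLorentzian B) {v a : V} (hv0 : v ≠ 0)
    (hv : B v v = 0) (hva : B v a = 0) (ha : ¬ ∃ c : ℝ, a = c • v) : 0 < B a a := by
  obtain ⟨hs, u, hu, hp⟩ := hB
  have huv : B u v ≠ 0 := fun h => absurd hv (hp v h hv0).ne'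
  -- Shifting `a` along `v` makes it orthogonal to `u` and leaves `B a a` unchanged, since `v` is
  -- null and orthogonal to `a`.
  have hw : B u (a - (B u a / B u v) • v) = 0 := by
    simp [div_mul_cancel₀ _ huv]
  have hne : a - (B u a / B u v) • v ≠ 0 := fun h => ha ⟨_, sub_eq_zero.1 h⟩
  have := hp _ hw hne
  simpa [hv, hva, hs a v] using this

/-- The shear `x ↦ x + c φ(x) v` along a vector `v` with `φ(v) = 0`. -/
def shear (φ : V →ₗ[ℝ] ℝ) (v : V) (hφ : φ v = 0) (c : ℝ) : V ≃ₗ[ℝ] V :=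
  LinearEquiv.ofLinearMap (LinearMap.id + (c • φ).smulRight v) (LinearMap.id - (c • φ).smulRight v)
    (by ext x; simp [hφ]) (by ext x; simp [hφ])

/-- `B'` is the pullback of `B` by a shear along `v`. Each of the two cross terms contributes half
of the correction, whence `f / 2`; the quadratic term dies because `v` is null. -/
theorem IsLorentzian.add_sq_null (hB : IsLorentzian B) {v : V} (hv : B v v = 0) (f : ℝ)
    {B' : LinearMap.BilinForm ℝ V} (h : ∀ x y, B' x y = B x y + f * (B v x * B v y)) :
    IsLorentzian B' := by
  refine hB.of_equiv (shear (B v) v hv (f / 2)) fun x y => ?_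
  rw [h]
  simp only [shear, LinearEquiv.coe_ofLinearMap, LinearMap.add_apply, LinearMap.id_coe, id_eq,
    LinearMap.smulRight_apply, LinearMap.smul_apply, smul_eq_mul, map_add, map_smul, hv,
    hB.1 x v]
  ring

variable {n : ℕ} {A : Matrix (Fin n) (Fin n) ℝ}

theorem isSymm_of_isLorentzian (hA : IsLorentzian (Matrix.toBilin' A)) : A.IsSymm := by
  ext i j
  simpa using hA.1 (Pi.single j 1) (Pi.single i 1)

theorem det_ne_zero_of_isLorentzian (hA : IsLorentzian (Matrix.toBilin' A)) : A.det ≠ 0 := by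
  intro h
  obtain ⟨x, hx, hAx⟩ := Matrix.exists_mulVec_eq_zero_iff.2 h
  exact hx (hA.eq_zero_of_forall fun w => by simp [Matrix.toBilin'_apply', hAx])

theorem isLorentzian_add_sq (hA : IsLorentzian (Matrix.toBilin' A)) {θ v : Fin n → ℝ}
    (hθ : A.mulVec v = θ) (hv : θ ⬝ᵥ v = 0) (f : ℝ) :
    IsLorentzian (Matrix.toBilin' (A + f • Matrix.vecMulVec θ θ)) := by
  have h1 : ∀ x, Matrix.toBilin' A v x = θ ⬝ᵥ x := fun x => by
    rw [hA.1, Matrix.toBilin'_apply', hθ, dotProduct_comm]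
  refine hA.add_sq_null (v := v) (by rw [h1, hv]) f fun x y => ?_
  rw [h1, h1]
  simp only [Matrix.toBilin'_apply', Matrix.add_mulVec, Matrix.smul_mulVec,
    Matrix.vecMulVec_mulVec, dotProduct_add, dotProduct_smul, smul_eq_mul,
    dotProduct_comm x θ]
  simp

end LorentzAlgebra

/-! ### Passage from tangent spaces to chart components. -/

section Charts

variable {n : ℕ} {M : Type*} [TopologicalSpace M] [ChartedSpace (Coord n) M]
  {e : OpenPartialHomeomorph M (Coord n)} {y : Coord n}

theorem mdifferentiable_of_mem_maximalAtlas (he : e ∈ IsManifold.maximalAtlas (𝓡 n) ∞ M) :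
    e.MDifferentiable (𝓡 n) (𝓡 n) :=
  ⟨(contMDiffOn_of_mem_maximalAtlas he).mdifferentiableOn (by simp),
    (contMDiffOn_symm_of_mem_maximalAtlas he).mdifferentiableOn (by simp)⟩

/-- The identification of `ℝⁿ` with a tangent space by the coordinate vectors. -/
def coordEquiv (he : e ∈ IsManifold.maximalAtlas (𝓡 n) ∞ M) (hy : y ∈ e.target) :
    (Fin n → ℝ) ≃ₗ[ℝ] TangentSpace (𝓡 n) (e.symm y) :=
  (WithLp.linearEquiv 2 ℝ (Fin n → ℝ)).symm.trans
    ((mdifferentiable_of_mem_maximalAtlas he).symm.mfderiv (x := y) hy).toLinearEquiv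

theorem toBilin'_bilinComponents (he : e ∈ IsManifold.maximalAtlas (𝓡 n) ∞ M) (hy : y ∈ e.target)
    (g : ∀ p : M, LinearMap.BilinForm ℝ (TangentSpace (𝓡 n) p)) (x z : Fin n → ℝ) :
    Matrix.toBilin' (bilinComponents g e y) x z =
      g (e.symm y) (coordEquiv he hy x) (coordEquiv he hy z) := by
  have : Matrix.toBilin' (bilinComponents g e y) =
      (g (e.symm y)).comp (coordEquiv he hy).toLinearMap (coordEquiv he hy).toLinearMap := by
    apply LinearMap.BilinForm.toMatrix'.injective
    ext i j
    rw [LinearMap.BilinForm.toMatrix'_toBilin', LinearMap.BilinForm.toMatrix'_apply]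
    rfl
  rw [this]
  rfl

theorem LorentzMetric.isLorentzian_components (g : LorentzMetric n M)
    (he : e ∈ IsManifold.maximalAtlas (𝓡 n) ∞ M) (hy : y ∈ e.target) :
    IsLorentzian (Matrix.toBilin' (g.components e y)) :=
  (g.lorentzian (e.symm y)).of_equiv (coordEquiv he hy) (toBilin'_bilinComponents he hy g.form)

end Charts

/-! ### Levi-Civita connection in coordinates. -/

section Connection

variable {n : ℕ} {U : Set (Coord n)} {y : Coord n}
  {G : Coord n → Matrix (Fin n) (Fin n) ℝ} {θ v : Coord n → Fin n → ℝ}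

/-- The covariant derivative `∇_b θ_d` of a 1-form. -/
def covDerivForm (G : Coord n → Matrix (Fin n) (Fin n) ℝ) (θ : Coord n → Fin n → ℝ) (b d : Fin n)
    (y : Coord n) : ℝ :=
  partialDeriv b (fun z => θ z d) y - ∑ e, christoffel G e b d y * θ y e

/-- The covariant derivative `∇_b vᵃ` of a vector field. -/
def covDerivVec (G : Coord n → Matrix (Fin n) (Fin n) ℝ) (v : Coord n → Fin n → ℝ) (b a : Fin n)
    (y : Coord n) : ℝ :=
  partialDeriv b (fun z => v z a) y + ∑ m, christoffel G a b m y * v y m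

theorem acceleration_eq (a : Fin n) :
    acceleration G v y a = ∑ l, v y l * covDerivVec G v l a y := rfl

theorem sum_mul_christoffel (hdet : (G y).det ≠ 0) (d b c : Fin n) :
    ∑ a, G y d a * christoffel G a b c y =
      (1 / 2) * (partialDeriv b (fun z => G z d c) y + partialDeriv c (fun z => G z d b) y
      - partialDeriv d (fun z => G z b c) y) := by
  set w : Fin n → ℝ := fun d => (1 / 2) * (partialDeriv b (fun z => G z d c) y +
    partialDeriv c (fun z => G z d b) y - partialDeriv d (fun z => G z b c) y) with hw
  have h1 : (fun a => christoffel G a b c y) = (G y)⁻¹.mulVec w := by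
    ext a
    simp only [christoffel, Matrix.mulVec, dotProduct, hw, Finset.mul_sum]
    exact Finset.sum_congr rfl fun _ _ => by ring
  have h2 : (G y).mulVec (fun a => christoffel G a b c y) = w := by
    rw [h1, Matrix.mulVec_mulVec, Matrix.mul_nonsing_inv _ (isUnit_iff_ne_zero.2 hdet),
      Matrix.one_mulVec]
  exact congrFun h2 d

theorem mulVec_raise (hdet : (G y).det ≠ 0) : (G y).mulVec (raise G θ y) = θ y := by
  have : raise G θ y = (G y)⁻¹.mulVec (θ y) := rfl
  rw [this, Matrix.mulVec_mulVec, Matrix.mul_nonsing_inv _ (isUnit_iff_ne_zero.2 hdet),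
    Matrix.one_mulVec]

/-- Identifies a raised index by solving a linear system, so that the inverse of the deformed metric
never has to be computed. -/
theorem eq_raise_of_mulVec (hdet : (G y).det ≠ 0) {w : Fin n → ℝ} (hw : (G y).mulVec w = θ y) :
    raise G θ y = w := by
  have : raise G θ y = (G y)⁻¹.mulVec (θ y) := rfl
  rw [this, ← hw, Matrix.mulVec_mulVec, Matrix.nonsing_inv_mul _ (isUnit_iff_ne_zero.2 hdet),
    Matrix.one_mulVec]

theorem partialDeriv_symm (hU : IsOpen U) (hy : y ∈ U) (hsymm : ∀ z ∈ U, (G z).IsSymm)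
    (i b c : Fin n) : partialDeriv i (fun z => G z b c) y = partialDeriv i (fun z => G z c b) y := by
  refine partialDeriv_congr ?_ i
  filter_upwards [hU.mem_nhds hy] with z hz using (hsymm z hz).apply c b

theorem christoffel_symm (hU : IsOpen U) (hy : y ∈ U) (hsymm : ∀ z ∈ U, (G z).IsSymm)
    (a b c : Fin n) : christoffel G a b c y = christoffel G a c b y := by
  simp only [christoffel]
  congr 1
  refine Finset.sum_congr rfl fun d _ => ?_
  rw [partialDeriv_symm hU hy hsymm d b c]
  ring

/-- The metric is covariantly constant. -/
theorem partialDeriv_metric (hU : IsOpen U) (hy : y ∈ U) (hsymm : ∀ z ∈ U, (G z).IsSymm)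
    (hdet : (G y).det ≠ 0) (b d c : Fin n) :
    partialDeriv b (fun z => G z d c) y =
      ∑ a, G y d a * christoffel G a b c y + ∑ a, G y c a * christoffel G a b d y := by
  rw [sum_mul_christoffel hdet, sum_mul_christoffel hdet, partialDeriv_symm hU hy hsymm b c d,
    partialDeriv_symm hU hy hsymm c b d, partialDeriv_symm hU hy hsymm d b c]
  ring

/-- Lowering an index commutes with the covariant derivative. -/
theorem covDerivForm_eq (hU : IsOpen U) (hy : y ∈ U) (hsymm : ∀ z ∈ U, (G z).IsSymm)
    (hG : ∀ i j, DifferentiableAt ℝ (fun z => G z i j) y)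
    (hv : ∀ i, DifferentiableAt ℝ (fun z => v z i) y)
    (hdet : (G y).det ≠ 0) (hθ : ∀ z ∈ U, (G z).mulVec (v z) = θ z) (b d : Fin n) :
    covDerivForm G θ b d y = ∑ e, G y d e * covDerivVec G v b e y := by
  have h1 : partialDeriv b (fun z => θ z d) y = ∑ e, (partialDeriv b (fun z => G z d e) y * v y e +
      G y d e * partialDeriv b (fun z => v z e) y) := by
    have : (fun z => θ z d) =ᶠ[𝓝 y] fun z => ∑ e, G z d e * v z e := by
      filter_upwards [hU.mem_nhds hy] with z hz
      rw [← hθ z hz]; rfl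
    rw [partialDeriv_congr this, partialDeriv_sum _ fun e _ => (hG d e).fun_mul (hv e)]
    exact Finset.sum_congr rfl fun e _ => partialDeriv_mul (hG d e) (hv e) b
  have h2 : ∑ e, christoffel G e b d y * θ y e =
      ∑ e, (∑ a, G y e a * christoffel G a b d y) * v y e := by
    simp only [← hθ y hy, Matrix.mulVec, dotProduct, Finset.mul_sum, Finset.sum_mul]
    rw [Finset.sum_comm]
    refine Finset.sum_congr rfl fun e _ => Finset.sum_congr rfl fun a _ => ?_
    rw [(hsymm y hy).apply e a]
    ring
  have h3 : ∑ e, G y d e * ∑ m, christoffel G e b m y * v y m =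
      ∑ e, (∑ a, G y d a * christoffel G a b e y) * v y e := by
    simp only [Finset.mul_sum, Finset.sum_mul]
    rw [Finset.sum_comm]
    exact Finset.sum_congr rfl fun e _ => Finset.sum_congr rfl fun a _ => by ring
  simp only [covDerivForm, covDerivVec, h1, h2, mul_add, Finset.sum_add_distrib, h3,
    partialDeriv_metric hU hy hsymm hdet, add_mul]
  ring

/-- For a null vector field `v` equivalent to `θ`, `v^d ∇_b θ_d = 0`. -/
theorem sum_covDeriv_null (hU : IsOpen U) (hy : y ∈ U) (hsymm : ∀ z ∈ U, (G z).IsSymm)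
    (hG : ∀ i j, DifferentiableAt ℝ (fun z => G z i j) y)
    (hv : ∀ i, DifferentiableAt ℝ (fun z => v z i) y)
    (hθd : ∀ i, DifferentiableAt ℝ (fun z => θ z i) y)
    (hdet : (G y).det ≠ 0) (hθ : ∀ z ∈ U, (G z).mulVec (v z) = θ z)
    (hnull : ∀ z ∈ U, ∑ i, θ z i * v z i = 0) (b : Fin n) :
    ∑ d, covDerivForm G θ b d y * v y d = 0 ∧ ∑ e, covDerivVec G v b e y * θ y e = 0 := by
  -- The two contractions are equal by lowering an index, and their sum is the derivative of the
  -- vanishing function θ_i v^i; hence both are zero.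
  have h1 : ∑ d, covDerivForm G θ b d y * v y d = ∑ e, covDerivVec G v b e y * θ y e := by
    simp only [covDerivForm_eq hU hy hsymm hG hv hdet hθ, ← hθ y hy, Matrix.mulVec, dotProduct,
      Finset.mul_sum, Finset.sum_mul]
    rw [Finset.sum_comm]
    refine Finset.sum_congr rfl fun e _ => Finset.sum_congr rfl fun a _ => ?_
    rw [(hsymm y hy).apply e a]
    ring
  have h2 : ∑ d, (partialDeriv b (fun z => θ z d) y * v y d +
      θ y d * partialDeriv b (fun z => v z d) y) = 0 := by
    rw [← partialDeriv_eq_zero hU hy hnull b,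
      partialDeriv_sum _ fun e _ => (hθd e).fun_mul (hv e)]
    exact Finset.sum_congr rfl fun e _ => (partialDeriv_mul (hθd e) (hv e) b).symm
  have h3 : ∑ d, (∑ e, christoffel G e b d y * θ y e) * v y d =
      ∑ e, (∑ m, christoffel G e b m y * v y m) * θ y e := by
    simp only [Finset.sum_mul]
    rw [Finset.sum_comm]
    exact Finset.sum_congr rfl fun e _ => Finset.sum_congr rfl fun a _ => by ring
  have h4 : ∑ d, covDerivForm G θ b d y * v y d + ∑ e, covDerivVec G v b e y * θ y e = 0 := by
    rw [← h2]
    simp only [covDerivForm, covDerivVec, sub_mul, add_mul, Finset.sum_add_distrib,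
      Finset.sum_sub_distrib, h3]
    rw [Finset.sum_congr rfl fun d _ => mul_comm (θ y d) _]
    ring
  constructor <;> linarith

end Connection

/-! ### The difference tensor and the change of the Ricci tensor. -/

section Deformation

section Contractions

variable {ι : Type*} [Fintype ι]

theorem sum_rotate_three (f : ι → ι → ι → ℝ) :
    ∑ d, ∑ l, ∑ m, f d l m = ∑ l, ∑ m, ∑ d, f d l m :=
  Finset.sum_comm.trans (Finset.sum_congr rfl fun _ _ => Finset.sum_comm)

theorem sum_rotate_four (f : ι → ι → ι → ι → ℝ) :
    ∑ b, ∑ d, ∑ l, ∑ m, f b d l m = ∑ l, ∑ m, ∑ d, ∑ b, f b d l m := by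
  rw [Finset.sum_congr rfl fun b _ => sum_rotate_three (f b), sum_rotate_three]
  exact Finset.sum_congr rfl fun l _ => Finset.sum_congr rfl fun m _ => Finset.sum_comm

theorem sum_contract (X Y : ι → ι → ι → ℝ) (v : ι → ℝ) :
    ∑ b, ∑ d, (∑ l, ∑ m, X l d m * Y m b l) * v b * v d =
      ∑ l, ∑ m, (∑ d, X l d m * v d) * ∑ b, Y m b l * v b := by
  simp only [Finset.sum_mul_sum]
  simp only [Finset.sum_mul]
  rw [sum_rotate_four]
  exact Finset.sum_congr rfl fun l _ => Finset.sum_congr rfl fun m _ =>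
    Finset.sum_congr rfl fun d _ => Finset.sum_congr rfl fun b _ => by ring

theorem sum_contract' (X : ι → ι → ℝ) (Y : ι → ι → ι → ℝ) (v : ι → ℝ) :
    ∑ b, ∑ d, (∑ l, ∑ m, X l m * Y m b d) * v b * v d =
      ∑ l, ∑ m, X l m * ∑ d, (∑ b, Y m b d * v b) * v d := by
  simp only [Finset.mul_sum, Finset.sum_mul]
  rw [sum_rotate_four]
  exact Finset.sum_congr rfl fun l _ => Finset.sum_congr rfl fun m _ =>
    Finset.sum_congr rfl fun d _ => Finset.sum_congr rfl fun b _ => by ring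

end Contractions

variable {n : ℕ} {U : Set (Coord n)} {y : Coord n}
  {G G' : Coord n → Matrix (Fin n) (Fin n) ℝ} {h : Coord n → ℝ} {θ v : Coord n → Fin n → ℝ}

theorem accelerationSq_eq_sum : accelerationSq G v y =
    ∑ a, acceleration G v y a * (G y).mulVec (acceleration G v y) a := by
  simp only [accelerationSq, Matrix.mulVec, dotProduct, Finset.mul_sum]
  exact Finset.sum_congr rfl fun _ _ => Finset.sum_congr rfl fun _ _ => by ring

/-- Two smooth metrics on an open set of `ℝⁿ`, linked by a generalized Kerr-Schild relation
`G' = G + h θ ⊗ θ` whose null 1-form `θ` is equivalent to the vector field `v`. -/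
structure IsKerrSchildPairOn (U : Set (Coord n)) (G G' : Coord n → Matrix (Fin n) (Fin n) ℝ)
    (h : Coord n → ℝ) (θ v : Coord n → Fin n → ℝ) : Prop where
  isOpen : IsOpen U
  symm : ∀ z ∈ U, (G z).IsSymm
  det : ∀ z ∈ U, (G z).det ≠ 0
  det' : ∀ z ∈ U, (G' z).det ≠ 0
  smooth : ∀ i j, ContDiffOn ℝ ∞ (fun z => G z i j) U
  smooth' : ∀ i j, ContDiffOn ℝ ∞ (fun z => G' z i j) U
  smooth_factor : ContDiffOn ℝ ∞ h U
  smooth_form : ∀ i, ContDiffOn ℝ ∞ (fun z => θ z i) U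
  smooth_vector : ∀ i, ContDiffOn ℝ ∞ (fun z => v z i) U
  mulVec_vector : ∀ z ∈ U, (G z).mulVec (v z) = θ z
  null : ∀ z ∈ U, ∑ i, θ z i * v z i = 0
  eq_addSq : ∀ z ∈ U, G' z = addSq G h θ z

/-- The difference of the Christoffel symbols of two metrics. -/
def christoffelDiff (G G' : Coord n → Matrix (Fin n) (Fin n) ℝ) (a b c : Fin n) (y : Coord n) : ℝ :=
  christoffel G' a b c y - christoffel G a b c y

namespace IsKerrSchildPairOn

variable (K : IsKerrSchildPairOn U G G' h θ v)
include K

theorem apply (hy : y ∈ U) (i j : Fin n) : G' y i j = G y i j + h y * (θ y i * θ y j) := by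
  rw [K.eq_addSq y hy]
  simp [addSq, Matrix.vecMulVec_apply]

theorem symm' (z : Coord n) (hz : z ∈ U) : (G' z).IsSymm := by
  ext i j
  rw [Matrix.transpose_apply, K.apply hz, K.apply hz, (K.symm z hz).apply]
  ring

theorem mulVec_apply (hy : y ∈ U) (w : Fin n → ℝ) (i : Fin n) :
    (G' y).mulVec w i = (G y).mulVec w i + h y * θ y i * ∑ j, θ y j * w j := by
  simp only [Matrix.mulVec, dotProduct, K.apply hy, Finset.mul_sum, ← Finset.sum_add_distrib]
  exact Finset.sum_congr rfl fun _ _ => by ring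

theorem mulVec_vector' (hy : y ∈ U) : (G' y).mulVec (v y) = θ y := by
  ext i
  rw [K.mulVec_apply hy, K.null y hy, K.mulVec_vector y hy, mul_zero, add_zero]

theorem raise_eq (hy : y ∈ U) : raise G' θ y = v y :=
  eq_raise_of_mulVec (K.det' y hy) (K.mulVec_vector' hy)

theorem contDiffOn_christoffelDiff (a b c : Fin n) :
    ContDiffOn ℝ ∞ (christoffelDiff G G' a b c) U :=
  (contDiffOn_christoffel K.isOpen K.smooth' K.det' a b c).sub
    (contDiffOn_christoffel K.isOpen K.smooth K.det a b c)

theorem christoffelDiff_symm (hy : y ∈ U) (a b c : Fin n) :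
    christoffelDiff G G' a b c y = christoffelDiff G G' a c b y := by
  rw [christoffelDiff, christoffelDiff, christoffel_symm K.isOpen hy K.symm,
    christoffel_symm K.isOpen hy K.symm']

theorem covDerivForm_eq (hy : y ∈ U) (b d : Fin n) :
    covDerivForm G θ b d y = ∑ e, G y d e * covDerivVec G v b e y :=
  KerrSchild.covDerivForm_eq K.isOpen hy K.symm
    (fun i j => (K.smooth i j).differentiableAt_of_isOpen K.isOpen hy)
    (fun i => (K.smooth_vector i).differentiableAt_of_isOpen K.isOpen hy) (K.det y hy)
    K.mulVec_vector b d

theorem sum_covDeriv (hy : y ∈ U) (b : Fin n) :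
    ∑ d, covDerivForm G θ b d y * v y d = 0 ∧ ∑ e, covDerivVec G v b e y * θ y e = 0 :=
  sum_covDeriv_null K.isOpen hy K.symm
    (fun i j => (K.smooth i j).differentiableAt_of_isOpen K.isOpen hy)
    (fun i => (K.smooth_vector i).differentiableAt_of_isOpen K.isOpen hy)
    (fun i => (K.smooth_form i).differentiableAt_of_isOpen K.isOpen hy) (K.det y hy)
    K.mulVec_vector K.null b

/-- The acceleration, with lowered index. -/
theorem sum_mul_covDerivForm (hy : y ∈ U) (d : Fin n) :
    ∑ b, v y b * covDerivForm G θ b d y = (G y).mulVec (acceleration G v y) d := by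
  simp only [K.covDerivForm_eq hy, Matrix.mulVec, dotProduct, acceleration_eq, Finset.mul_sum]
  rw [Finset.sum_comm]
  exact Finset.sum_congr rfl fun _ _ => Finset.sum_congr rfl fun _ _ => by ring

theorem sum_form_mul_acceleration (hy : y ∈ U) : ∑ a, θ y a * acceleration G v y a = 0 := by
  have : ∑ a, θ y a * acceleration G v y a =
      ∑ l, v y l * ∑ a, covDerivVec G v l a y * θ y a := by
    simp only [acceleration_eq, Finset.mul_sum]
    rw [Finset.sum_comm]
    exact Finset.sum_congr rfl fun _ _ => Finset.sum_congr rfl fun _ _ => by ring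
  rw [this]
  exact Finset.sum_eq_zero fun l _ => by rw [(K.sum_covDeriv hy l).2, mul_zero]

/-- The extra term of `G'` carries the factor θ_j a^j, which vanishes. -/
theorem mulVec_acceleration (hy : y ∈ U) :
    (G' y).mulVec (acceleration G v y) = (G y).mulVec (acceleration G v y) := by
  ext i
  rw [K.mulVec_apply hy, K.sum_form_mul_acceleration hy, mul_zero, add_zero]

theorem sum_lower_acceleration_mul (hy : y ∈ U) :
    ∑ d, (G y).mulVec (acceleration G v y) d * v y d = 0 := by
  simp only [← K.sum_mul_covDerivForm hy, Finset.sum_mul]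
  rw [Finset.sum_comm]
  refine Finset.sum_eq_zero fun b _ => ?_
  rw [← mul_zero (v y b), ← (K.sum_covDeriv hy b).1, Finset.mul_sum]
  exact Finset.sum_congr rfl fun _ _ => by ring

theorem partialDeriv_apply (hy : y ∈ U) (b i j : Fin n) :
    partialDeriv b (fun z => G' z i j) y = partialDeriv b (fun z => G z i j) y +
      (partialDeriv b h y * (θ y i * θ y j) + h y * (partialDeriv b (fun z => θ z i) y * θ y j +
        θ y i * partialDeriv b (fun z => θ z j) y)) := by
  have hθ := fun i => (K.smooth_form i).differentiableAt_of_isOpen K.isOpen hy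
  have hh := K.smooth_factor.differentiableAt_of_isOpen K.isOpen hy
  have : (fun z => G' z i j) =ᶠ[𝓝 y] fun z => G z i j + h z * (θ z i * θ z j) := by
    filter_upwards [K.isOpen.mem_nhds hy] with z hz using K.apply hz i j
  rw [partialDeriv_congr this, partialDeriv_add
    ((K.smooth i j).differentiableAt_of_isOpen K.isOpen hy)
    (hh.fun_mul ((hθ i).fun_mul (hθ j))), partialDeriv_mul hh ((hθ i).fun_mul (hθ j)),
    partialDeriv_mul (hθ i) (hθ j)]

/-- This is (1/2)(∇_b k_{dc} + ∇_c k_{db} - ∇_d k_{bc}) for k = h θ⊗θ, expanded by the product rule.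
Its free indices are lowered with `G'`, so no inverse metric enters. -/
theorem sum_mul_christoffelDiff (hy : y ∈ U) (d b c : Fin n) :
    ∑ a, G' y d a * christoffelDiff G G' a b c y = (1 / 2) *
      (partialDeriv b h y * θ y d * θ y c + partialDeriv c h y * θ y d * θ y b
        - partialDeriv d h y * θ y b * θ y c
        + h y * (covDerivForm G θ b d y * θ y c + θ y d * covDerivForm G θ b c y
          + covDerivForm G θ c d y * θ y b + θ y d * covDerivForm G θ c b y
          - covDerivForm G θ d b y * θ y c - θ y b * covDerivForm G θ d c y)) := by
  -- The first two sums are Christoffel symbols of the first kind; the last supplies the terms that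
  -- turn ∂θ into ∇θ.
  have hsum : ∑ a, G' y d a * christoffelDiff G G' a b c y =
      ∑ a, G' y d a * christoffel G' a b c y - (∑ a, G y d a * christoffel G a b c y +
        h y * θ y d * ∑ a, christoffel G a b c y * θ y a) := by
    simp only [christoffelDiff, Finset.mul_sum, ← Finset.sum_add_distrib,
      ← Finset.sum_sub_distrib]
    exact Finset.sum_congr rfl fun a _ => by rw [K.apply hy d a]; ring
  have hΓ : ∀ b c, ∑ a, christoffel G a b c y * θ y a = ∑ a, christoffel G a c b y * θ y a :=
    fun b c => Finset.sum_congr rfl fun a _ => by rw [christoffel_symm K.isOpen hy K.symm]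
  rw [hsum, sum_mul_christoffel (K.det y hy), sum_mul_christoffel (K.det' y hy),
    K.partialDeriv_apply hy, K.partialDeriv_apply hy, K.partialDeriv_apply hy]
  simp only [covDerivForm]
  rw [hΓ c d, hΓ b d, hΓ c b]
  ring

theorem christoffelDiff_eq (hy : y ∈ U) (a b c : Fin n) : christoffelDiff G G' a b c y =
    ∑ d, (G' y)⁻¹ a d * ∑ e, G' y d e * christoffelDiff G G' e b c y := by
  have : (G' y)⁻¹.mulVec ((G' y).mulVec fun e => christoffelDiff G G' e b c y) =
      fun e => christoffelDiff G G' e b c y := by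
    rw [Matrix.mulVec_mulVec, Matrix.nonsing_inv_mul _ (isUnit_iff_ne_zero.2 (K.det' y hy)),
      Matrix.one_mulVec]
  exact (congrFun this a).symm

/-- Reflects the equality of the volume densities of the two metrics. -/
theorem christoffelDiff_trace (hy : y ∈ U) (b : Fin n) :
    ∑ a, christoffelDiff G G' a b a y = 0 := by
  set D : Fin n → Fin n → ℝ := fun d c => ∑ e, G' y d e * christoffelDiff G G' e b c y with hD
  have hI : ∀ a d, (G' y)⁻¹ a d = (G' y)⁻¹ d a := fun a d => by
    have h1 := (K.symm' y hy).inv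
    exact h1.apply d a
  have hr : ∀ a, ∑ d, (G' y)⁻¹ a d * θ y d = v y a := fun a => congrFun (K.raise_eq hy) a
  have h1 : ∑ a, christoffelDiff G G' a b a y = ∑ a, ∑ d, (G' y)⁻¹ a d * D d a :=
    Finset.sum_congr rfl fun a _ => K.christoffelDiff_eq hy a b a
  have h2 : ∑ a, ∑ d, (G' y)⁻¹ a d * D d a = ∑ a, ∑ d, (G' y)⁻¹ a d * D a d := by
    rw [Finset.sum_comm]
    exact Finset.sum_congr rfl fun a _ => Finset.sum_congr rfl fun d _ => by rw [hI]
  -- Symmetrizing `D` leaves ∇_b(h θ_d θ_a). Its trace with the inverse of `G'` involves only θ_a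
  -- v^a and v^a ∇_b θ_a, both zero.
  have h3 : ∑ a, ∑ d, (G' y)⁻¹ a d * D d a + ∑ a, ∑ d, (G' y)⁻¹ a d * D a d =
      partialDeriv b h y * (∑ a, θ y a * ∑ d, (G' y)⁻¹ a d * θ y d) +
      2 * (h y * ∑ a, covDerivForm G θ b a y * ∑ d, (G' y)⁻¹ a d * θ y d) := by
    have h4 : ∑ a, covDerivForm G θ b a y * ∑ d, (G' y)⁻¹ a d * θ y d =
        ∑ a, θ y a * ∑ d, (G' y)⁻¹ a d * covDerivForm G θ b d y := by
      simp only [Finset.mul_sum]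
      rw [Finset.sum_comm]
      exact Finset.sum_congr rfl fun a _ => Finset.sum_congr rfl fun d _ => by rw [hI]; ring
    rw [two_mul]
    nth_rw 2 [h4]
    simp only [Finset.mul_sum, ← Finset.sum_add_distrib]
    refine Finset.sum_congr rfl fun a _ => Finset.sum_congr rfl fun d _ => ?_
    simp only [hD, K.sum_mul_christoffelDiff hy]
    ring
  simp only [hr, K.null y hy, (K.sum_covDeriv hy b).1] at h3
  rw [h1]
  linarith

/-- The contraction `Cᵃ_{bc} v^b` of the difference tensor. -/
theorem sum_christoffelDiff_mul (hy : y ∈ U) (a c : Fin n) :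
    ∑ b, christoffelDiff G G' a b c y * v y b = (1 / 2) *
      (((∑ b, partialDeriv b h y * v y b) * v y a + h y * acceleration G v y a) * θ y c +
        h y * v y a * (G y).mulVec (acceleration G v y) c) := by
  set q := ∑ b, partialDeriv b h y * v y b with hq
  set α := (G y).mulVec (acceleration G v y) with hα
  suffices H : (fun a => ∑ b, christoffelDiff G G' a b c y * v y b) = (1 / 2 : ℝ) •
      (θ y c • (q • v y + h y • acceleration G v y) + (h y * α c) • v y) by
    refine (congrFun H a).trans ?_
    simp only [Pi.smul_apply, Pi.add_apply, smul_eq_mul]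
    ring
  -- The vectors are compared after lowering with `G'`, which sends v to θ and the acceleration to
  -- `α`.
  apply Matrix.mulVec_injective_of_isUnit
    ((Matrix.isUnit_iff_isUnit_det _).2 (isUnit_iff_ne_zero.2 (K.det' y hy)))
  simp only [Matrix.mulVec_smul, Matrix.mulVec_add, K.mulVec_vector' hy, K.mulVec_acceleration hy]
  rw [← hα]
  ext d
  have h1 : (G' y).mulVec (fun a => ∑ b, christoffelDiff G G' a b c y * v y b) d =
      ∑ b, v y b * ∑ a, G' y d a * christoffelDiff G G' a b c y := by
    simp only [Matrix.mulVec, dotProduct, Finset.mul_sum]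
    rw [Finset.sum_comm]
    exact Finset.sum_congr rfl fun _ _ => Finset.sum_congr rfl fun _ _ => by ring
  have h2 : ∑ b, v y b * ∑ a, G' y d a * christoffelDiff G G' a b c y = (1 / 2) *
      ((∑ b, partialDeriv b h y * v y b) * θ y d * θ y c
        + (partialDeriv c h y * θ y d - partialDeriv d h y * θ y c) * (∑ b, θ y b * v y b)
        + h y * ((∑ b, v y b * covDerivForm G θ b d y) * θ y c
          + θ y d * (∑ b, v y b * covDerivForm G θ b c y)
          + (covDerivForm G θ c d y - covDerivForm G θ d c y) * (∑ b, θ y b * v y b)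
          + θ y d * (∑ b, covDerivForm G θ c b y * v y b)
          - (∑ b, covDerivForm G θ d b y * v y b) * θ y c)) := by
    simp only [Finset.mul_sum, Finset.sum_mul, ← Finset.sum_add_distrib,
      ← Finset.sum_sub_distrib]
    refine Finset.sum_congr rfl fun b _ => ?_
    rw [← Finset.mul_sum, K.sum_mul_christoffelDiff hy]
    ring
  rw [h1, h2, K.null y hy, (K.sum_covDeriv hy c).1, (K.sum_covDeriv hy d).1,
    K.sum_mul_covDerivForm hy, K.sum_mul_covDerivForm hy, ← hα, ← hq]
  simp only [Pi.smul_apply, Pi.add_apply, smul_eq_mul]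
  ring

/-- Both terms of the single contraction die: θ and the lowered acceleration annihilate v. -/
theorem sum_sum_christoffelDiff_mul (hy : y ∈ U) (a : Fin n) :
    ∑ c, (∑ b, christoffelDiff G G' a b c y * v y b) * v y c = 0 := by
  have : ∑ c, (∑ b, christoffelDiff G G' a b c y * v y b) * v y c = (1 / 2) *
      (((∑ b, partialDeriv b h y * v y b) * v y a + h y * acceleration G v y a) *
        (∑ c, θ y c * v y c) +
        h y * v y a * ∑ c, (G y).mulVec (acceleration G v y) c * v y c) := by
    simp only [K.sum_christoffelDiff_mul hy]
    simp only [mul_add, Finset.mul_sum, ← Finset.sum_add_distrib]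
    exact Finset.sum_congr rfl fun c _ => by ring
  rw [this, K.null y hy, K.sum_lower_acceleration_mul hy]
  ring

theorem acceleration_eq (hy : y ∈ U) : acceleration G' v y = acceleration G v y := by
  ext a
  rw [← sub_eq_zero, ← K.sum_sum_christoffelDiff_mul hy a]
  simp only [acceleration, ← Finset.sum_sub_distrib]
  refine Finset.sum_congr rfl fun l _ => ?_
  rw [← mul_sub, add_sub_add_left_eq_sub, ← Finset.sum_sub_distrib, mul_comm]
  congr 1
  refine Finset.sum_congr rfl fun m _ => ?_
  rw [K.christoffelDiff_symm hy, christoffelDiff]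
  ring

theorem accelerationSq_eq (hy : y ∈ U) : accelerationSq G' v y = accelerationSq G v y := by
  rw [accelerationSq_eq_sum, K.acceleration_eq hy, K.mulVec_acceleration hy,
    accelerationSq_eq_sum]

/-- The right side is ∇_l C^l_{bd} - C^l_{dm} C^m_{bl} written out; the other terms of the usual
difference formula contain the trace of C. -/
theorem ricci_sub (hy : y ∈ U) (b d : Fin n) : ricci G' b d y - ricci G b d y =
    ∑ l, partialDeriv l (christoffelDiff G G' l b d) y
    + ∑ l, ∑ m, christoffel G l l m y * christoffelDiff G G' m b d y
    - ∑ l, ∑ m, christoffel G l d m y * christoffelDiff G G' m b l y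
    - ∑ l, ∑ m, christoffelDiff G G' l d m y * christoffel G m b l y
    - ∑ l, ∑ m, christoffelDiff G G' l d m y * christoffelDiff G G' m b l y := by
  have hΓ : ∀ a b c, DifferentiableAt ℝ (christoffel G a b c) y := fun a b c =>
    (contDiffOn_christoffel K.isOpen K.smooth K.det a b c).differentiableAt_of_isOpen K.isOpen hy
  have hC : ∀ a b c, DifferentiableAt ℝ (christoffelDiff G G' a b c) y := fun a b c =>
    (K.contDiffOn_christoffelDiff a b c).differentiableAt_of_isOpen K.isOpen hy
  have hadd : ∀ a b c, christoffel G' a b c =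
      fun z => christoffel G a b c z + christoffelDiff G G' a b c z := fun a b c => by
    ext z
    rw [christoffelDiff]
    ring
  have hp : ∀ i a b c, partialDeriv i (christoffel G' a b c) y =
      partialDeriv i (christoffel G a b c) y + partialDeriv i (christoffelDiff G G' a b c) y :=
    fun i a b c => by rw [hadd, partialDeriv_add (hΓ a b c) (hC a b c)]
  have ht1 : ∑ l, partialDeriv d (christoffelDiff G G' l b l) y = 0 := by
    rw [← partialDeriv_sum _ fun l _ => hC l b l]
    exact partialDeriv_eq_zero K.isOpen hy (fun z hz => K.christoffelDiff_trace hz b) d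
  have ht2 : ∀ f : Fin n → ℝ, ∑ l, ∑ m, christoffelDiff G G' l l m y * f m = 0 := fun f => by
    rw [Finset.sum_comm]
    refine Finset.sum_eq_zero fun m _ => ?_
    rw [← Finset.sum_mul, ← zero_mul (f m), ← K.christoffelDiff_trace hy m]
    congr 1
    exact Finset.sum_congr rfl fun l _ => K.christoffelDiff_symm hy l l m
  have e1 := ht2 fun m => christoffel G m b d y
  have e2 := ht2 fun m => christoffelDiff G G' m b d y
  simp only [ricci, riemann, hp]
  simp only [hadd, add_mul, mul_add, Finset.sum_add_distrib, Finset.sum_sub_distrib] at *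
  linarith

/-- The effect of a generalized Kerr-Schild deformation on the null component of the Ricci
tensor. -/
theorem ricciContracted_eq (hy : y ∈ U) :
    ricciContracted G' v y = ricciContracted G v y - h y * accelerationSq G v y := by
  set C := christoffelDiff G G' with hCdef
  set q := ∑ b, partialDeriv b h y * v y b with hq
  set A := acceleration G v y with hA
  set α := (G y).mulVec A with hα
  set B : Fin n → Fin n → ℝ := fun l d => ∑ b, C l b d y * v y b with hB
  have hBval : ∀ l d, B l d = (1 / 2) * ((q * v y l + h y * A l) * θ y d + h y * v y l * α d) :=
    fun l d => K.sum_christoffelDiff_mul hy l d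
  have hBs : ∀ l d, ∑ b, C l d b y * v y b = B l d := fun l d =>
    Finset.sum_congr rfl fun b _ => by rw [hCdef, K.christoffelDiff_symm hy]
  have hv : ∀ i, DifferentiableAt ℝ (fun z => v z i) y := fun i =>
    (K.smooth_vector i).differentiableAt_of_isOpen K.isOpen hy
  have hC : ∀ a b c, DifferentiableAt ℝ (C a b c) y := fun a b c =>
    (K.contDiffOn_christoffelDiff a b c).differentiableAt_of_isOpen K.isOpen hy
  have h0 : ricciContracted G' v y - ricciContracted G v y =
      ∑ b, ∑ d, (ricci G' b d y - ricci G b d y) * v y b * v y d := by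
    simp only [ricciContracted, ← Finset.sum_sub_distrib, sub_mul]
  -- Differentiate C^l_{bd} v^b v^d = 0. The derivatives of the two factors v contribute equally by
  -- the symmetry of C, whence the factor -2.
  have hT1 : ∑ b, ∑ d, (∑ l, partialDeriv l (C l b d) y) * v y b * v y d =
      -2 * ∑ l, ∑ d, B l d * partialDeriv l (fun z => v z d) y := by
    have hl : ∀ l, ∑ d, ∑ b, (partialDeriv l (C l b d) y * v y b * v y d) =
        -2 * ∑ d, B l d * partialDeriv l (fun z => v z d) y := fun l => by
      have hz := partialDeriv_eq_zero K.isOpen hy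
        (fun z hz => K.sum_sum_christoffelDiff_mul hz l) l
      have hd : ∀ d, DifferentiableAt ℝ (fun z => ∑ b, C l b d z * v z b) y := fun d =>
        DifferentiableAt.fun_sum fun b _ => (hC l b d).fun_mul (hv b)
      rw [partialDeriv_sum _ fun d _ => (hd d).fun_mul (hv d)] at hz
      have hz' : ∀ d, partialDeriv l (fun z => (∑ b, C l b d z * v z b) * v z d) y =
          ∑ b, (partialDeriv l (C l b d) y * v y b * v y d) +
          (∑ b, C l b d y * v y d * partialDeriv l (fun z => v z b) y) +
          B l d * partialDeriv l (fun z => v z d) y := fun d => by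
        rw [partialDeriv_mul (hd d) (hv d), partialDeriv_sum _ fun b _ => (hC l b d).fun_mul (hv b),
          Finset.sum_mul, ← Finset.sum_add_distrib]
        congr 1
        refine Finset.sum_congr rfl fun b _ => ?_
        rw [partialDeriv_mul (hC l b d) (hv b)]
        ring
      rw [Finset.sum_congr rfl fun d _ => hz' d, Finset.sum_add_distrib,
        Finset.sum_add_distrib] at hz
      have hswap : ∑ d, ∑ b, C l b d y * v y d * partialDeriv l (fun z => v z b) y =
          ∑ d, B l d * partialDeriv l (fun z => v z d) y := by
        rw [Finset.sum_comm]
        exact Finset.sum_congr rfl fun b _ => by rw [← Finset.sum_mul, hBs]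
      linarith
    rw [Finset.mul_sum, ← Finset.sum_congr rfl fun l _ => hl l]
    simp only [Finset.sum_mul]
    rw [Finset.sum_comm, sum_rotate_three, sum_rotate_three]
  have hT2 : ∑ b, ∑ d, (∑ l, ∑ m, christoffel G l l m y * C m b d y) * v y b * v y d = 0 := by
    rw [sum_contract' (fun l m => christoffel G l l m y) (fun m b d => C m b d y)]
    exact Finset.sum_eq_zero fun l _ => Finset.sum_eq_zero fun m _ => by
      rw [K.sum_sum_christoffelDiff_mul hy m, mul_zero]
  -- This term and the next are equal; together they complete the ∂_l v^d of `hT1` to ∇_l v^d.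
  have hT4 : ∑ b, ∑ d, (∑ l, ∑ m, C l d m y * christoffel G m b l y) * v y b * v y d =
      ∑ l, ∑ d, B l d * ∑ m, christoffel G d l m y * v y m := by
    rw [sum_contract (fun l d m => C l d m y) (fun m b l => christoffel G m b l y)]
    refine Finset.sum_congr rfl fun l _ => Finset.sum_congr rfl fun m _ => ?_
    congr 1
    exact Finset.sum_congr rfl fun b _ => by rw [christoffel_symm K.isOpen hy K.symm]
  have hT3 : ∑ b, ∑ d, (∑ l, ∑ m, christoffel G l d m y * C m b l y) * v y b * v y d =
      ∑ l, ∑ d, B l d * ∑ m, christoffel G d l m y * v y m := by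
    rw [sum_contract (fun l d m => christoffel G l d m y) (fun m b l => C m b l y),
      Finset.sum_comm]
    refine Finset.sum_congr rfl fun l _ => Finset.sum_congr rfl fun m _ => ?_
    rw [mul_comm]
    congr 1
    exact Finset.sum_congr rfl fun b _ => by rw [christoffel_symm K.isOpen hy K.symm]
  have hT5 : ∑ b, ∑ d, (∑ l, ∑ m, C l d m y * C m b l y) * v y b * v y d =
      ∑ l, ∑ m, B l m * B m l :=
    sum_contract (fun l d m => C l d m y) (fun m b l => C m b l y) (v y)
  have hαv : ∑ d, α d * v y d = 0 := K.sum_lower_acceleration_mul hy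
  have hθA : ∑ a, θ y a * A a = 0 := K.sum_form_mul_acceleration hy
  -- Every product in tr(B²) contains θ·v, α·v or the pairing of θ with q v + h a, and all of these
  -- vanish.
  have hBB : ∑ l, ∑ m, B l m * B m l = 0 := by
    have hu : ∑ l, (q * v y l + h y * A l) * θ y l = 0 := by
      have : ∑ l, (q * v y l + h y * A l) * θ y l =
          q * ∑ l, θ y l * v y l + h y * ∑ l, θ y l * A l := by
        simp only [Finset.mul_sum, ← Finset.sum_add_distrib]
        exact Finset.sum_congr rfl fun _ _ => by ring
      rw [this, K.null y hy, hθA]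
      ring
    have : ∑ l, ∑ m, B l m * B m l = (1 / 4) *
        ((∑ l, (q * v y l + h y * A l) * θ y l) * (∑ m, (q * v y m + h y * A m) * θ y m) +
        h y * ((∑ l, (q * v y l + h y * A l) * α l) * (∑ m, θ y m * v y m)) +
        h y * ((∑ l, θ y l * v y l) * (∑ m, (q * v y m + h y * A m) * α m)) +
        h y * (h y * ((∑ l, α l * v y l) * (∑ m, α m * v y m)))) := by
      simp only [Finset.sum_mul_sum]
      simp only [Finset.mul_sum, ← Finset.sum_add_distrib]
      refine Finset.sum_congr rfl fun l _ => Finset.sum_congr rfl fun m _ => ?_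
      rw [hBval, hBval]
      ring
    rw [this, hu, hαv, K.null y hy]
    ring
  -- The part of B along θ_d drops out by θ_d ∇_l v^d = 0; the part v^l α_d produces the
  -- acceleration paired with itself.
  have hBP : ∑ l, ∑ d, B l d * covDerivVec G v l d y =
      (1 / 2) * (h y * accelerationSq G v y) := by
    have : ∑ l, ∑ d, B l d * covDerivVec G v l d y =
        (1 / 2) * ((∑ l, (q * v y l + h y * A l) * ∑ d, covDerivVec G v l d y * θ y d) +
          h y * ∑ l, ∑ d, v y l * covDerivVec G v l d y * α d) := by
      simp only [Finset.mul_sum, ← Finset.sum_add_distrib]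
      refine Finset.sum_congr rfl fun l _ => Finset.sum_congr rfl fun d _ => ?_
      rw [hBval]
      ring
    rw [this, Finset.sum_eq_zero fun l _ => by rw [(K.sum_covDeriv hy l).2, mul_zero], zero_add,
      Finset.sum_comm, accelerationSq_eq_sum]
    congr 2
    exact Finset.sum_congr rfl fun d _ => by rw [← Finset.sum_mul]; rfl
  have hP : ∑ l, ∑ d, B l d * covDerivVec G v l d y =
      ∑ l, ∑ d, B l d * partialDeriv l (fun z => v z d) y +
      ∑ l, ∑ d, B l d * ∑ m, christoffel G d l m y * v y m := by
    simp only [covDerivVec, mul_add, Finset.sum_add_distrib]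
  simp only [K.ricci_sub hy, sub_mul, add_mul, Finset.sum_add_distrib,
    Finset.sum_sub_distrib] at h0
  linarith

end IsKerrSchildPairOn

end Deformation

/-! ### From metrics on the manifold to pairs in a chart. -/

section KerrSchildMetrics

variable {n : ℕ} {M : Type*} [TopologicalSpace M] [ChartedSpace (Coord n) M]
  {e : OpenPartialHomeomorph M (Coord n)} {y : Coord n}

/-- At a zero of θ the acceleration v^l ∇_l v also vanishes, hence is a multiple of v. -/
theorem OneForm.components_ne_zero {g : LorentzMetric n M} {θ : OneForm n M}
    (hng : θ.IsNonGeodesic g) (he : e ∈ IsManifold.maximalAtlas (𝓡 n) ∞ M) (hy : y ∈ e.target) :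
    θ.components e y ≠ 0 := by
  intro h0
  have hv : θ.vector g e y = 0 := by
    ext a
    simp [OneForm.vector, raise, h0]
  exact hng e he y hy ⟨0, by ext a; simp [acceleration, hv]⟩

theorem isKerrSchildPairOn_components {g g' : LorentzMetric n M} {θ : OneForm n M} {H : M → ℝ}
    (hnull : θ.IsNull g) (hng : θ.IsNonGeodesic g)
    (hKS : ∀ (p : M) (v w : TangentSpace (𝓡 n) p),
      g'.form p v w = g.form p v w + 2 * H p * (θ.form p v * θ.form p w))
    (he : e ∈ IsManifold.maximalAtlas (𝓡 n) ∞ M) :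
    IsKerrSchildPairOn e.target (g.components e) (g'.components e)
      (fun y => 2 * H (e.symm y)) (θ.components e) (θ.vector g e) := by
  have hdet : ∀ y ∈ e.target, (g.components e y).det ≠ 0 := fun y hy =>
    det_ne_zero_of_isLorentzian (g.isLorentzian_components he hy)
  have hadd : ∀ y ∈ e.target, g'.components e y =
      addSq (g.components e) (fun y => 2 * H (e.symm y)) (θ.components e) y := fun y _ => by
    ext i j
    exact hKS (e.symm y) (coordVector e y i) (coordVector e y j)
  exact
    { isOpen := e.open_target
      symm := fun y hy => isSymm_of_isLorentzian (g.isLorentzian_components he hy)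
      det := hdet
      det' := fun y hy => det_ne_zero_of_isLorentzian (g'.isLorentzian_components he hy)
      smooth := g.smooth e he
      smooth' := g'.smooth e he
      -- `H` is an arbitrary function; its smoothness is recovered from that of the metrics because
      -- θ has no zeros.
      smooth_factor := contDiffOn_factor e.open_target (g.smooth e he) (g'.smooth e he)
        (θ.smooth e he) (fun y hy => OneForm.components_ne_zero hng he hy) hadd
      smooth_form := θ.smooth e he
      smooth_vector := contDiffOn_raise (g.smooth e he) hdet (θ.smooth e he)
      mulVec_vector := fun y hy => mulVec_raise (hdet y hy)
      null := hnull e he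
      eq_addSq := hadd }

end KerrSchildMetrics

end KerrSchild

end

/-! ### The theorem. -/

theorem mainTheorem6 {n : ℕ} {M : Type*} [TopologicalSpace M]
    [ChartedSpace (KerrSchild.Coord n) M] [IsManifold (𝓡 n) ∞ M]
    (g g' : KerrSchild.LorentzMetric n M) (θ : KerrSchild.OneForm n M) (H : M → ℝ)
    (hnull : θ.IsNull g) (hng : θ.IsNonGeodesic g)
    (hKS : ∀ (p : M) (v w : TangentSpace (𝓡 n) p),
      g'.form p v w = g.form p v w + 2 * H p * (θ.form p v * θ.form p w))
    (e : OpenPartialHomeomorph M (KerrSchild.Coord n))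
    (he : e ∈ IsManifold.maximalAtlas (𝓡 n) ∞ M) :
    let G := g.components e
    let G' := g'.components e
    let l := θ.components e
    let v := θ.vector g e
    let aSq := KerrSchild.accelerationSq G v
    let γ := KerrSchild.addSq G (fun y => KerrSchild.ricciContracted G v y / aSq y) l
    let γ' := KerrSchild.addSq G' (fun y => KerrSchild.ricciContracted G' v y / aSq y) l
    -- `a²` does not vanish, and the vector field of `ℓ` and `a²` are the same for both metrics
    (∀ y ∈ e.target, aSq y ≠ 0 ∧ θ.vector g' e y = v y ∧
      KerrSchild.accelerationSq G' (θ.vector g' e) y = aSq y) ∧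
    -- the deformed tensors are metrics
    KerrSchild.IsLorentzMetricOn γ e.target ∧ KerrSchild.IsLorentzMetricOn γ' e.target ∧
    -- their Riemann tensors agree
    ∀ y ∈ e.target, ∀ α β μ ν : Fin n,
      KerrSchild.riemann γ α β μ ν y = KerrSchild.riemann γ' α β μ ν y := by
  intro G G' l v aSq γ γ'
  have K : KerrSchild.IsKerrSchildPairOn e.target G G' (fun y => 2 * H (e.symm y)) l v :=
    KerrSchild.isKerrSchildPairOn_components hnull hng hKS he
  have hraise : ∀ y ∈ e.target, θ.vector g' e y = v y := fun y hy => K.raise_eq hy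
  have hL : ∀ y ∈ e.target, KerrSchild.IsLorentzian (Matrix.toBilin' (G y)) := fun y hy =>
    g.isLorentzian_components he hy
  have ha : ∀ y ∈ e.target, aSq y ≠ 0 := fun y hy => by
    have hB : ∀ w, Matrix.toBilin' (G y) (v y) w = ∑ i, l y i * w i := fun w => by
      rw [(hL y hy).1, Matrix.toBilin'_apply', K.mulVec_vector y hy, dotProduct_comm]
      rfl
    have hv0 : v y ≠ 0 := fun h => KerrSchild.OneForm.components_ne_zero hng he hy <|
      (K.mulVec_vector y hy).symm.trans (by rw [h, Matrix.mulVec_zero])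
    have hpos := (hL y hy).pos_of_orthogonal_null hv0 ((hB _).trans (K.null y hy))
      ((hB _).trans (K.sum_form_mul_acceleration hy)) (hng e he y hy)
    rw [Matrix.toBilin'_apply'] at hpos
    exact (hpos.trans_eq KerrSchild.accelerationSq_eq_sum.symm).ne'
  have hγ : KerrSchild.IsLorentzMetricOn γ e.target := by
    refine ⟨fun i j => (K.smooth i j).add (ContDiffOn.mul ?_
      ((K.smooth_form i).mul (K.smooth_form j))), fun y hy => ?_⟩
    · exact (KerrSchild.contDiffOn_ricciContracted K.isOpen K.smooth K.det K.smooth_vector).div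
        (KerrSchild.contDiffOn_accelerationSq K.isOpen K.smooth K.det K.smooth_vector) ha
    · exact KerrSchild.isLorentzian_add_sq (hL y hy) (K.mulVec_vector y hy) (K.null y hy) _
  -- The factor h in `G'` cancels the -h a² / a² coming from its contracted Ricci tensor.
  have heq : ∀ y ∈ e.target, γ y = γ' y := fun y hy => by
    ext i j
    simp only [γ, γ', KerrSchild.addSq, Matrix.add_apply, Matrix.smul_apply,
      Matrix.vecMulVec_apply, smul_eq_mul, K.apply hy, K.ricciContracted_eq hy]
    have := ha y hy
    simp only [aSq] at this ⊢
    field_simp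
    ring
  refine ⟨fun y hy => ⟨ha y hy, hraise y hy, ?_⟩, hγ,
    ⟨fun i j => (hγ.1 i j).congr fun y hy => by rw [heq y hy], fun y hy => heq y hy ▸ hγ.2 y hy⟩,
    fun y hy α β μ ν => ?_⟩
  -- The acceleration differentiates the vector field, so equality is needed on a neighbourhood.
  · have hev : θ.vector g' e =ᶠ[nhds y] v := by
      filter_upwards [K.isOpen.mem_nhds hy] with z hz using hraise z hz
    rw [KerrSchild.accelerationSq_congr hev, K.accelerationSq_eq hy]
  · refine KerrSchild.riemann_congr ?_ α β μ ν
    filter_upwards [K.isOpen.mem_nhds hy] with z hz using heq z hz
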